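/- Identify subsets of $\omega$ with points of Cantor space $2^\omega$, let $\lambda$ be the uniform (fair-coin) product measure on $2^\omega$, and for a finite binary string $\sigma$ let $[\sigma]$ be the set of $X\in 2^\omega$ extending $\sigma$. Use the following definitions for an oracle $A\subseteq\omega$. - $A$ is of *hyperimmune degree* if there is a function $f\colon\omega\to\omega$ with $f\le_T A$ such that for no computable $g\colon\omega\to\omega$ does $f(n)\le g(n)$ hold for almost all $n$. - A *Kurtz test* is a sequence $(G_m)_{m\in\omega}$ of clopen subsets of $2^\omega$ with $\lambda(G_m)\le 2^{-m}$ for all $m$ that is effective, i.e. from $m$ one can compute a finite list $D_m$ of strings with $G_m=\bigcup_{\sigma\in D_m}[\sigma]$. A *Kurtz null set* is a set of the form $\bigcap_m G_m$ for a Kurtz test $(G_m)$. - A *Schnorr test relative to $A$* is a sequence $(G_m)_{m\in\omega}$ of uniformly $\Sigma^0_1(A)$ subsets of $2^\omega$ (i.e. $G_m=\bigcup_{\sigma\in W_m}[\sigma]$ with the sets of strings $W_m$ computably enumerable in $A$ uniformly in $m$) such that $\lambda(G_m)\le 2^{-m}$ for all $m$ and $\lambda(G_m)$ is an $A$-computable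 real uniformly in $m$. A set $N\subseteq 2^\omega$ is *Schnorr null relative to $A$* if $N\subseteq\bigcap_m G_m$ for some Schnorr test $(G_m)$ relative to $A$. - $A$ is *Schnorr-Kurtz engulfing* if the union of all Kurtz null sets is Schnorr null relative to $A$. **Theorem.** For every oracle $A$, the following are equivalent: (i) $A$ is of hyperimmune degree; (ii) $A$ is Schnorr-Kurtz engulfing. -/

import Mathlib

open MeasureTheory Filter

namespace SchnorrKurtz

/-- Cantor space `2^ω`; its elements (the reals) are identified with subsets of `ω` through
characteristic functions.  Turing oracles are also taken from here. -/
abbrev Cantor : Type := ℕ → Bool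

/-- The characteristic function of `A`, as the (total) oracle function `ℕ →. ℕ`. -/
def oracleFun (A : Cantor) : ℕ →. ℕ := fun n => Part.some (A n).toNat

/-- `f ≤_T A`: the total function `f` is computable with oracle `A`. -/
def ComputableFrom {α σ : Type} [Primcodable α] [Primcodable σ] (A : Cantor) (f : α → σ) : Prop :=
  ComputableIn {oracleFun A} f

/-- `A` is of hyperimmune degree: some `f ≤_T A` is not dominated by any computable function,
i.e. there is no computable `g` with `f n ≤ g n` for almost all `n`. -/
def IsOfHyperimmuneDegree (A : Cantor) : Prop :=
  ∃ f : ℕ → ℕ, ComputableFrom A f ∧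
    ∀ g : ℕ → ℕ, Computable g → ¬ ∀ᶠ n in atTop, f n ≤ g n

/-- The basic clopen set `[σ]` of all infinite sequences extending the finite string `σ`. -/
def cyl (σ : List Bool) : Set Cantor :=
  {X | ∀ (i : ℕ) (hi : i < σ.length), X i = σ[i]}

/-- The clopen set `⋃_{σ ∈ D} [σ]` with strong index the finite list `D` of strings.
By compactness, every clopen subset of Cantor space has this form. -/
def clopen (D : List (List Bool)) : Set Cantor := ⋃ σ ∈ D, cyl σ

/-- The uniform (fair coin) product measure on Cantor space. -/
noncomputable def coinMeasure : Measure Cantor :=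
  Measure.infinitePi fun _ : ℕ => (PMF.uniformOfFintype Bool).toMeasure

/-- A Kurtz test: an effective sequence of clopen sets (computably given by strong indices)
whose `m`-th member has measure at most `2^{-m}`. -/
def IsKurtzTest (G : ℕ → Set Cantor) : Prop :=
  (∃ D : ℕ → List (List Bool), Computable D ∧ ∀ m, G m = clopen (D m)) ∧
    ∀ m, coinMeasure (G m) ≤ (2⁻¹ : ENNReal) ^ m

/-- A Kurtz null set: the intersection of a Kurtz test. -/
def IsKurtzNull (K : Set Cantor) : Prop :=
  ∃ G : ℕ → Set Cantor, IsKurtzTest G ∧ K = ⋂ m, G m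

/-- `G` is a uniformly `Σ⁰₁(A)` sequence of open sets: `G m` is the union of the basic clopen
sets `[σ]` for `σ` in a set of strings that is enumerated with oracle `A`, uniformly in `m`
(at each stage the enumeration lists at most one string, so that empty sets are allowed). -/
def IsUniformlySigmaOneIn (A : Cantor) (G : ℕ → Set Cantor) : Prop :=
  ∃ e : ℕ × ℕ → Option (List Bool), ComputableFrom A e ∧
    ∀ m, G m = {X | ∃ s : ℕ, ∃ σ ∈ e (m, s), X ∈ cyl σ}

/-- The nonnegative reals `x m` are computable with oracle `A`, uniformly in `m`: from `m` and `k`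
one can compute a dyadic rational `a / 2^k` at distance at most `2^{-k}` from `x m`. -/
def IsUniformlyComputableRealIn (A : Cantor) (x : ℕ → ℝ) : Prop :=
  ∃ a : ℕ × ℕ → ℕ, ComputableFrom A a ∧
    ∀ m k : ℕ, |x m - (a (m, k) : ℝ) / 2 ^ k| ≤ (1 / 2 : ℝ) ^ k

/-- A Schnorr test relative to `A`: a uniformly `Σ⁰₁(A)` sequence whose `m`-th member has measure
at most `2^{-m}`, this measure being an `A`-computable real uniformly in `m`. -/
def IsSchnorrTestIn (A : Cantor) (G : ℕ → Set Cantor) : Prop :=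
  IsUniformlySigmaOneIn A G ∧
    (∀ m, coinMeasure (G m) ≤ (2⁻¹ : ENNReal) ^ m) ∧
    IsUniformlyComputableRealIn A fun m => (coinMeasure (G m)).toReal

/-- A set is Schnorr null relative to `A` if it is contained in the intersection of a Schnorr test
relative to `A`. -/
def IsSchnorrNullIn (A : Cantor) (N : Set Cantor) : Prop :=
  ∃ G : ℕ → Set Cantor, IsSchnorrTestIn A G ∧ N ⊆ ⋂ m, G m

/-- `A` is Schnorr-Kurtz engulfing: the union of all Kurtz null sets is Schnorr null relative
to `A`. -/
def IsSchnorrKurtzEngulfing (A : Cantor) : Prop :=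
  IsSchnorrNullIn A (⋃₀ {K | IsKurtzNull K})

end SchnorrKurtz

/-! From (i) to (ii), let `f ≤_T A` be dominated by no computable function. At level `n`, run each
program `e ≤ n` for `f n` steps on input `n + e + 2` and keep its output if it describes a clopen
set of measure at most `2^{-(n+e+2)}`. The running time of a program computing a Kurtz test is a
computable function of `n`, so `f` exceeds it infinitely often and the intersection of the test lies
in infinitely many levels. The tails of the levels thus form one Schnorr test relative to `A`
covering all Kurtz null sets (`isSchnorrTestIn_tails`).

From (ii) to (i), let `G` be a component of measure at most `1/2` of an engulfing test. `A` computes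
good clopen approximations to `G` from inside (`exists_approx`). If a computable function bounded
the lengths of their strings, zeros could be placed computably at positions the approximations do
not see. Such a zero halves the approximated part, and the errors are too small for `G` to swallow
all these sequences (`exists_mem_zerosAt_notMem`), though they form a Kurtz null set. -/

namespace ComputableIn

/-! ### Closure properties of relative computability -/

open Encodable Part

variable {α β γ σ : Type*} [Primcodable α] [Primcodable β] [Primcodable γ] [Primcodable σ]
variable {O : Set (ℕ →. ℕ)}

theorem comp {f : β → σ} {g : α → β} (hf : ComputableIn O f) (hg : ComputableIn O g) :
    ComputableIn O fun a => f (g a) :=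
  (Nat.RecursiveIn.comp hf hg).of_eq fun n => by
    simp only [map_some, bind_eq_bind]
    rcases e : decode (α := α) n with - | a <;> simp [encodek]

theorem pair {f : α → β} {g : α → γ} (hf : ComputableIn O f) (hg : ComputableIn O g) :
    ComputableIn O fun a => (f a, g a) :=
  (Nat.RecursiveIn.pair hf hg).of_eq fun n => by cases decode (α := α) n <;> simp [Seq.seq]

theorem nat_rec {g : σ} {h : ℕ × σ → σ} (hh : ComputableIn O h) :
    ComputableIn O fun n : ℕ => Nat.rec (motive := fun _ => σ) g (fun y IH => h (y, IH)) n := by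
  have hz : Nat.RecursiveIn O fun _ => Part.some (encode g) :=
    RecursiveIn.iff_nat.1 (ComputableIn.const (α := ℕ) (encode g)).recursiveIn
  have hs := Nat.RecursiveIn.comp hh .right
  have hp : Nat.RecursiveIn O fun n => Part.some (Nat.pair 0 n) :=
    RecursiveIn.iff_nat.1
      (Primrec₂.natPair.comp (.const 0) .id : Primrec fun n => Nat.pair 0 n).computableIn.recursiveIn
  refine ((Nat.RecursiveIn.prec hz hs).comp hp).of_eq fun n => ?_
  simp only [bind_eq_bind, bind_some, Nat.unpair_pair, decode_nat, coe_some, map_some]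
  induction n with
  | zero => simp
  | succ n ih =>
    dsimp only
    rw [ih]
    simp [encodek]

theorem list_map_range {f : ℕ → σ} (hf : ComputableIn O f) :
    ComputableIn O fun n => (List.range n).map f := by
  have hstep : ComputableIn O fun p : ℕ × List σ => p.2 ++ [f p.1] :=
    (Primrec.list_concat.computableIn₂ : ComputableIn O fun p : List σ × σ => p.1 ++ [p.2]).comp
      (ComputableIn.snd.pair (hf.comp ComputableIn.fst))
  have := nat_rec (g := ([] : List σ)) hstep
  have e : (fun n => (List.range n).map f) =
      fun n : ℕ => Nat.rec (motive := fun _ => List σ) [] (fun y IH => IH ++ [f y]) n := by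
    funext n
    induction n with
    | zero => rfl
    | succ n ih => simp only [List.range_succ, List.map_append, ih]; rfl
  rw [e]
  exact this

/-- Unbounded search is total when a witness always exists. With the empty oracle this also serves
for plain computability. -/
theorem exists_search {p : ℕ × ℕ → Bool} (hp : ComputableIn O p) (H : ∀ a, ∃ n, p (a, n) = true) :
    ∃ s : ℕ → ℕ, ComputableIn O s ∧ ∀ a, p (a, s a) = true := by
  -- `rfind` looks for a zero, so truth is coded by `0`.
  have hq : ComputableIn O fun x : ℕ × ℕ => cond (p x) 0 1 :=
    (Primrec.dom_bool fun b => cond b 0 1).computableIn.comp hp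
  have hq' : ComputableIn O fun n : ℕ => cond (p n.unpair) 0 1 := hq.comp .unpair
  have hr := Nat.RecursiveIn.rfind (RecursiveIn.iff_nat.1 hq'.recursiveIn)
  refine ⟨fun a => Nat.find (H a), RecursiveIn.iff_nat.2 (hr.of_eq_tot fun a => ?_),
    fun a => Nat.find_spec (H a)⟩
  refine Nat.mem_rfind.2 ⟨?_, fun {m} hm => ?_⟩
  · simp [Nat.find_spec (H a)]
  · simp [Nat.find_min (H a) hm]

end ComputableIn

/-! ### Binary strings, clopen sets and their measures -/

namespace SchnorrKurtz

/-- The list of all binary strings of length `n`. -/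
def strings (n : ℕ) : List (List Bool) :=
  Nat.rec [[]] (fun _ l => l.map (· ++ [false]) ++ l.map (· ++ [true])) n

theorem strings_succ (n : ℕ) :
    strings (n + 1) = (strings n).map (· ++ [false]) ++ (strings n).map (· ++ [true]) := rfl

theorem mem_strings {n : ℕ} {τ : List Bool} : τ ∈ strings n ↔ τ.length = n := by
  induction n generalizing τ with
  | zero => simp [strings]
  | succ n ih =>
    simp only [strings_succ, List.mem_append, List.mem_map, ih]
    constructor
    · rintro (⟨a, rfl, rfl⟩ | ⟨a, rfl, rfl⟩) <;> simp
    · intro h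
      have hne : τ ≠ [] := by rintro rfl; simp at h
      have hd : τ.dropLast.length = n := by simp [h]
      have he := List.dropLast_append_getLast hne
      cases hb : τ.getLast hne
      · exact .inl ⟨_, hd, by rwa [hb] at he⟩
      · exact .inr ⟨_, hd, by rwa [hb] at he⟩

theorem nodup_strings (n : ℕ) : (strings n).Nodup := by
  induction n with
  | zero => simp [strings]
  | succ n ih =>
    rw [strings_succ, List.nodup_append']
    refine ⟨ih.map (List.append_left_injective _), ih.map (List.append_left_injective _), ?_⟩
    rw [List.disjoint_left]
    intro τ h₁ h₂
    simp only [List.mem_map] at h₁ h₂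
    obtain ⟨a, -, rfl⟩ := h₁
    obtain ⟨b, -, hb⟩ := h₂
    have := congrArg List.getLast? hb
    simp at this

theorem primrec_strings : Primrec strings :=
  Primrec.nat_rec₁ [[]] (Primrec.list_append.comp
    (Primrec.list_map Primrec.snd (Primrec.list_concat.comp Primrec.snd (Primrec.const false)).to₂)
    (Primrec.list_map Primrec.snd
      (Primrec.list_concat.comp Primrec.snd (Primrec.const true)).to₂)).to₂

/-- The initial segment of length `n` of `X`. -/
def pre (X : Cantor) (n : ℕ) : List Bool := (List.range n).map X

@[simp] theorem length_pre (X : Cantor) (n : ℕ) : (pre X n).length = n := by simp [pre]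

theorem take_pre (X : Cantor) {m n : ℕ} (h : m ≤ n) : (pre X n).take m = pre X m := by
  simp [pre, ← List.map_take, List.take_range, h]

theorem getElem?_pre (X : Cantor) {m n : ℕ} (h : m < n) : (pre X n)[m]? = some (X m) := by
  simp [pre, h]

theorem mem_cyl_iff {X : Cantor} {σ : List Bool} : X ∈ cyl σ ↔ pre X σ.length = σ := by
  simp only [cyl, Set.mem_ofPred_eq]
  constructor
  · intro h
    refine List.ext_getElem (by simp) fun i h₁ h₂ => ?_
    simp [pre, h i h₂]
  · intro h i hi
    have := getElem?_pre X hi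
    rw [h, List.getElem?_eq_getElem hi] at this
    exact (Option.some.inj this).symm

theorem isClopen_coord (i : ℕ) (b : Bool) : IsClopen {X : Cantor | X i = b} :=
  (isClopen_discrete {b}).preimage (continuous_apply i)

theorem isClopen_cyl (σ : List Bool) : IsClopen (cyl σ) := by
  have : cyl σ = ⋂ i : Fin σ.length, {X : Cantor | X i = σ[i]} := by
    ext X
    simp only [cyl, Set.mem_ofPred_eq, Set.mem_iInter]
    exact ⟨fun h i => h i i.2, fun h i hi => h ⟨i, hi⟩⟩
  rw [this]
  exact isClopen_iInter_of_finite fun i => isClopen_coord _ _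

theorem isClopen_clopen (D : List (List Bool)) : IsClopen (clopen D) := by
  have : clopen D = ⋃ σ ∈ {σ | σ ∈ D}, cyl σ := by simp [clopen]
  rw [this]
  exact D.finite_toSet.isClopen_biUnion fun σ _ => isClopen_cyl σ

theorem measurableSet_clopen (D : List (List Bool)) : MeasurableSet (clopen D) :=
  (isClopen_clopen D).isOpen.measurableSet

instance : IsProbabilityMeasure coinMeasure := by
  unfold coinMeasure; infer_instance

theorem coinMeasure_cyl (σ : List Bool) : coinMeasure (cyl σ) = (2⁻¹ : ENNReal) ^ σ.length := by
  have : cyl σ = Set.pi (Finset.range σ.length : Finset ℕ) fun i => {σ.getD i false} := by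
    ext X
    simp only [cyl, Set.mem_ofPred_eq, Set.mem_pi, Finset.coe_range, Set.mem_Iio,
      Set.mem_singleton_iff]
    refine forall_congr' fun i => forall_congr' fun hi => ?_
    rw [List.getD_eq_getElem _ _ hi]
  rw [this, coinMeasure, Measure.infinitePi_pi _ (fun _ _ => measurableSet_singleton _)]
  simp

/-- A set given by a condition on the first `n` bits has as measure the proportion of strings of
length `n` that satisfy the condition. -/
theorem coinMeasure_real_pre (n : ℕ) (P : List Bool → Prop) [DecidablePred P] :
    coinMeasure.real {X | P (pre X n)} = ((strings n).countP (P ·) : ℝ) / 2 ^ n := by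
  have hf : ∀ τ ∈ (strings n).toFinset.filter P,
      coinMeasure ((fun X => pre X n) ⁻¹' {τ}) = (2⁻¹ : ENNReal) ^ n ∧
        MeasurableSet ((fun X => pre X n) ⁻¹' {τ}) := by
    intro τ hτ
    have hl : τ.length = n := by
      simpa [mem_strings] using (Finset.mem_filter.1 hτ).1
    have : (fun X => pre X n) ⁻¹' {τ} = cyl τ := by
      ext X
      rw [mem_cyl_iff, hl]; rfl
    rw [this]
    exact ⟨by rw [coinMeasure_cyl, hl], (isClopen_cyl τ).isOpen.measurableSet⟩
  have hs : {X | P (pre X n)} =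
      (fun X => pre X n) ⁻¹' (((strings n).toFinset.filter P : Finset (List Bool)) : Set _) := by
    ext X
    simp [mem_strings]
  have hfilter : (strings n).toFinset.filter P = ((strings n).filter (P ·)).toFinset := by
    ext; simp
  rw [hs, Measure.real, ← sum_measure_preimage_singleton _ fun τ hτ => (hf τ hτ).2,
    Finset.sum_congr rfl fun τ hτ => (hf τ hτ).1, Finset.sum_const, hfilter,
    List.toFinset_card_of_nodup ((nodup_strings n).filter _), ← List.countP_eq_length_filter]
  simp [ENNReal.toReal_pow, div_eq_mul_inv]

/-- `τ` extends some string in the list `D`. -/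
def Extends (τ : List Bool) (D : List (List Bool)) : Prop := ∃ σ ∈ D, τ.take σ.length = σ

instance : DecidableRel Extends := fun τ D => by unfold Extends; infer_instance

/-- A bound for the lengths of the strings in `D`. -/
def level (D : List (List Bool)) : ℕ := D.flatten.length

/-- The number of strings of length `level D` that extend a string in `D`. -/
def count (D : List (List Bool)) : ℕ := ((strings (level D)).filter (Extends · D)).length

theorem primrec_level : Primrec level := Primrec.list_length.comp Primrec.list_flatten

theorem primrecRel_extends : PrimrecRel Extends := by
  have h : PrimrecRel fun (σ τ : List Bool) => τ.take σ.length = σ :=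
    Primrec.eq.comp (Primrec.list_take.comp (Primrec.list_length.comp Primrec.fst) Primrec.snd)
      Primrec.fst
  exact h.exists_mem_list.swap

theorem primrec_count : Primrec count :=
  Primrec.list_length.comp
    (primrecRel_extends.listFilter.comp (primrec_strings.comp primrec_level) Primrec.id)

theorem length_le_level {D : List (List Bool)} {σ : List Bool} (h : σ ∈ D) :
    σ.length ≤ level D :=
  (List.sublist_flatten_of_mem h).length_le

theorem mem_clopen_iff {X : Cantor} {D : List (List Bool)} :
    X ∈ clopen D ↔ ∃ σ ∈ D, pre X σ.length = σ := by
  simp [clopen, mem_cyl_iff]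

theorem mem_clopen_iff_extends {X : Cantor} {D : List (List Bool)} :
    X ∈ clopen D ↔ Extends (pre X (level D)) D := by
  rw [mem_clopen_iff]
  refine exists_congr fun σ => and_congr_right fun h => ?_
  rw [take_pre X (length_le_level h)]

theorem coinMeasure_real_clopen (D : List (List Bool)) :
    coinMeasure.real (clopen D) = (count D : ℝ) / 2 ^ level D := by
  have : clopen D = {X | Extends (pre X (level D)) D} := by
    ext X; exact mem_clopen_iff_extends
  rw [this, coinMeasure_real_pre (level D) (Extends · D), count, List.countP_eq_length_filter]

/-- Membership in `C` depends only on the first `n` bits. -/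
def DeterminedBelow (n : ℕ) (C : Set Cantor) : Prop := ∀ X Y, pre X n = pre Y n → X ∈ C → Y ∈ C

theorem DeterminedBelow.mono {m n : ℕ} {C : Set Cantor} (h : DeterminedBelow m C) (hmn : m ≤ n) :
    DeterminedBelow n C := fun X Y e => h X Y (by rw [← take_pre X hmn, e, take_pre Y hmn])

theorem DeterminedBelow.inter {n : ℕ} {C C' : Set Cantor} (h : DeterminedBelow n C)
    (h' : DeterminedBelow n C') : DeterminedBelow n (C ∩ C') :=
  fun X Y e hX => ⟨h X Y e hX.1, h' X Y e hX.2⟩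

theorem determinedBelow_clopen (D : List (List Bool)) : DeterminedBelow (level D) (clopen D) := by
  intro X Y e
  rw [mem_clopen_iff_extends, mem_clopen_iff_extends, e]
  exact id

/-- Fixing a bit beyond those that `C` depends on halves the measure. -/
theorem coinMeasure_real_inter_coord {n : ℕ} {C : Set Cantor} (h : DeterminedBelow n C) :
    coinMeasure.real (C ∩ {X | X n = false}) = coinMeasure.real C / 2 := by
  classical
  -- Since `C` is determined below `n`, it is recovered from the prefixes of length `n` of its
  -- members.
  let P : List Bool → Prop := fun τ => ∃ X ∈ C, pre X n = τ
  let Q : List Bool → Prop := fun τ => P (τ.take n) ∧ τ[n]? = some false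
  have hC : C = {X | P (pre X n)} := by
    ext X
    exact ⟨fun hX => ⟨X, hX, rfl⟩, fun ⟨Y, hY, e⟩ => h Y X e hY⟩
  have hQ : C ∩ {X | X n = false} = {X | Q (pre X (n + 1))} := by
    ext X
    simp only [Q, Set.mem_inter_iff, Set.mem_ofPred_eq, take_pre X n.le_succ,
      getElem?_pre X n.lt_succ_self, Option.some_inj]
    exact and_congr_left fun _ => by rw [hC]; rfl
  -- Each string of length `n` has two one-bit extensions, and only the one by `false` can satisfy
  -- `Q`.
  have hcount : (strings (n + 1)).countP (Q ·) = (strings n).countP (P ·) := by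
    rw [strings_succ, List.countP_append, List.countP_map, List.countP_map]
    have h₁ : (strings n).countP ((Q ·) ∘ (· ++ [false])) = (strings n).countP (P ·) := by
      refine List.countP_congr fun τ hτ => ?_
      obtain rfl := mem_strings.1 hτ
      simp [Q]
    have h₂ : (strings n).countP ((Q ·) ∘ (· ++ [true])) = 0 := by
      refine List.countP_eq_zero.2 fun τ hτ => ?_
      obtain rfl := mem_strings.1 hτ
      simp [Q]
    rw [h₁, h₂, add_zero]
  rw [hQ, coinMeasure_real_pre (n + 1) Q, hcount, hC, coinMeasure_real_pre n P, pow_succ]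
  ring

/-! ### Clopen approximations to Schnorr tests -/

theorem primrec_pow : Primrec₂ fun a b : ℕ => a ^ b := Primrec₂.unpaired'.1 Nat.Primrec.pow

theorem mem_clopen_filterMap_iff {f : ℕ → Option (List Bool)} {s : ℕ} {X : Cantor} :
    X ∈ clopen (((List.range s).map f).filterMap id) ↔ ∃ t < s, ∃ σ ∈ f t, X ∈ cyl σ := by
  simp only [clopen, Set.mem_iUnion, List.mem_filterMap, List.mem_map, List.mem_range, id_eq,
    exists_prop, Option.mem_def]
  constructor
  · rintro ⟨σ, ⟨_, ⟨t, ht, rfl⟩, h⟩, hX⟩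
    exact ⟨t, ht, σ, h, hX⟩
  · rintro ⟨t, ht, σ, h, hX⟩
    exact ⟨σ, ⟨_, ⟨t, ht, rfl⟩, h⟩, hX⟩

theorem IsUniformlySigmaOneIn.isOpen {A : Cantor} {G : ℕ → Set Cantor}
    (h : IsUniformlySigmaOneIn A G) (m : ℕ) : IsOpen (G m) := by
  obtain ⟨e, -, he⟩ := h
  have : G m = ⋃ s, ⋃ σ ∈ {σ | σ ∈ e (m, s)}, cyl σ := by
    rw [he]; ext X; simp
  rw [this]
  exact isOpen_iUnion fun s => isOpen_biUnion fun σ _ => (isClopen_cyl σ).isOpen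

/-- The components of a Schnorr test relative to `A` can be approximated from inside by clopen
sets, with oracle `A` and at any prescribed precision. -/
theorem IsSchnorrTestIn.exists_approx {A : Cantor} {G : ℕ → Set Cantor} (hG : IsSchnorrTestIn A G)
    (m : ℕ) : ∃ D : ℕ → List (List Bool), ComputableFrom A D ∧
      ∀ n, clopen (D n) ⊆ G m ∧
        coinMeasure.real (G m \ clopen (D n)) ≤ (1 / 2 : ℝ) ^ (2 * n + 3) := by
  obtain ⟨⟨e, he, hGe⟩, -, a, ha, hGa⟩ := hG
  let S : ℕ → List (List Bool) := fun s => ((List.range s).map fun t => e (m, t)).filterMap id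
  have hS : ComputableFrom A S :=
    (Primrec.listFilterMap .id Primrec.snd.to₂ :
      Primrec fun l : List (Option (List Bool)) => l.filterMap id).computableIn.comp
      (ComputableIn.list_map_range
        (he.comp ((ComputableIn.const m).pair ComputableIn.id)))
  have hSG : ∀ s, clopen (S s) ⊆ G m := by
    intro s X hX
    obtain ⟨t, -, σ, h, hσ⟩ := mem_clopen_filterMap_iff.1 hX
    rw [hGe]
    exact ⟨t, σ, h, hσ⟩
  have hmono : Monotone fun s => clopen (S s) := by
    intro s s' hs X hX
    obtain ⟨t, ht, h⟩ := mem_clopen_filterMap_iff.1 hX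
    exact mem_clopen_filterMap_iff.2 ⟨t, ht.trans_le hs, h⟩
  have hUnion : ⋃ s, clopen (S s) = G m := by
    refine Set.Subset.antisymm (Set.iUnion_subset hSG) fun X hX => ?_
    rw [hGe] at hX
    obtain ⟨t, h⟩ := hX
    exact Set.mem_iUnion.2 ⟨t + 1, mem_clopen_filterMap_iff.2 ⟨t, t.lt_succ_self, h⟩⟩
  have hlim : Tendsto (fun s => coinMeasure.real (clopen (S s))) atTop
      (nhds (coinMeasure.real (G m))) := by
    rw [← hUnion]
    exact (ENNReal.tendsto_toReal (measure_ne_top _ _)).comp (tendsto_measure_iUnion_atTop hmono)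
  -- With `ε = 2^{-(2n+5)}` and `b` an `ε`-approximation to the measure of `G m`, the test asks in
  -- integers whether the clopen set has measure at least `b - 2ε`. Passing it leaves an error of at
  -- most `3ε`, below the permitted `4ε = 2^{-(2n+3)}`.
  let T : (ℕ × ℕ) × List (List Bool) → Bool := fun x =>
    decide (x.1.2 * 2 ^ level x.2 ≤ count x.2 * 2 ^ (2 * x.1.1 + 5) + 2 * 2 ^ level x.2)
  have hT : Primrec T := by
    have hpl : Primrec fun x : (ℕ × ℕ) × List (List Bool) => 2 ^ level x.2 :=
      primrec_pow.comp (.const 2) (primrec_level.comp .snd)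
    exact Primrec.nat_le.decide.comp (Primrec.nat_mul.comp (Primrec.snd.comp .fst) hpl)
      (Primrec.nat_add.comp
        (Primrec.nat_mul.comp (primrec_count.comp .snd)
          (primrec_pow.comp (.const 2) (Primrec.nat_add.comp
            (Primrec.nat_mul.comp (.const 2) (Primrec.fst.comp .fst)) (.const 5))))
        (Primrec.nat_mul.comp (.const 2) hpl))
  have hT_iff : ∀ n b D, T ((n, b), D) = true ↔
      (b : ℝ) / 2 ^ (2 * n + 5) - 2 / 2 ^ (2 * n + 5) ≤ coinMeasure.real (clopen D) := by
    intro n b D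
    rw [decide_eq_true_iff, coinMeasure_real_clopen, ← sub_div,
      div_le_div_iff₀ (by positivity) (by positivity), ← Nat.cast_le (α := ℝ)]
    push_cast
    rw [sub_mul, sub_le_iff_le_add]
  have hp : ComputableFrom A fun x : ℕ × ℕ => T ((x.1, a (m, 2 * x.1 + 5)), S x.2) := by
    have hk : Primrec fun x : ℕ × ℕ => (m, 2 * x.1 + 5) :=
      Primrec.pair (.const m) (Primrec.nat_add.comp
        (Primrec.nat_mul.comp (.const 2) .fst) (.const 5))
    exact hT.computableIn.comp
      ((ComputableIn.fst.pair (ha.comp hk.computableIn)).pair (hS.comp ComputableIn.snd))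
  have hε : ∀ n : ℕ, (0 : ℝ) < 1 / 2 ^ (2 * n + 5) := fun n => by positivity
  have hab : ∀ n : ℕ, |coinMeasure.real (G m) - (a (m, 2 * n + 5) : ℝ) / 2 ^ (2 * n + 5)| ≤
      1 / 2 ^ (2 * n + 5) := fun n => by
    rw [← one_div_pow]; exact hGa m (2 * n + 5)
  have htwo : ∀ n : ℕ, (2 : ℝ) / 2 ^ (2 * n + 5) = 2 * (1 / 2 ^ (2 * n + 5)) := fun n => by ring
  -- The search halts: a stage missing less than `ε` of `G m` passes the test.
  obtain ⟨s, hs, hsT⟩ := ComputableIn.exists_search hp fun n => by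
    obtain ⟨t, ht⟩ := (hlim.eventually
      (lt_mem_nhds (sub_lt_self (coinMeasure.real (G m)) (hε n)))).exists
    refine ⟨t, (hT_iff _ _ _).2 ?_⟩
    have := abs_le.1 (hab n)
    rw [htwo]
    linarith
  refine ⟨fun n => S (s n), hS.comp hs, fun n => ⟨hSG _, ?_⟩⟩
  have h₁ := (hT_iff _ _ _).1 (hsT n)
  have h₂ := abs_le.1 (hab n)
  rw [measureReal_sdiff (hSG _) (measurableSet_clopen _)]
  have h₃ : (1 / 2 : ℝ) ^ (2 * n + 3) = 4 * (1 / 2 ^ (2 * n + 5)) := by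
    rw [one_div_pow, pow_add, pow_add]; ring
  rw [htwo] at h₁
  have := hε n
  linarith

/-! ### Engulfing implies hyperimmune degree -/

/-- The sequences that vanish at the first `n` positions listed by `i`. -/
def zerosAt (i : ℕ → ℕ) (n : ℕ) : Set Cantor := {X | ∀ j < n, X (i j) = false}

theorem zerosAt_zero (i : ℕ → ℕ) : zerosAt i 0 = Set.univ := by
  ext; simp [zerosAt]

theorem zerosAt_succ (i : ℕ → ℕ) (n : ℕ) :
    zerosAt i (n + 1) = zerosAt i n ∩ {X | X (i n) = false} := by
  ext X
  simp only [zerosAt, Set.mem_ofPred_eq, Set.mem_inter_iff, Nat.lt_succ_iff_lt_or_eq]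
  exact ⟨fun h => ⟨fun j hj => h j (.inl hj), h n (.inr rfl)⟩,
    fun h j hj => hj.elim (h.1 j) fun e => e ▸ h.2⟩

theorem isClosed_zerosAt (i : ℕ → ℕ) (n : ℕ) : IsClosed (zerosAt i n) := by
  induction n with
  | zero => rw [zerosAt_zero]; exact isClosed_univ
  | succ n ih => rw [zerosAt_succ]; exact ih.inter (isClopen_coord _ _).isClosed

theorem determinedBelow_zerosAt {i : ℕ → ℕ} (hi : StrictMono i) (n : ℕ) :
    DeterminedBelow (i n) (zerosAt i n) := by
  intro X Y e hX j hj
  have h := getElem?_pre Y (hi hj)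
  rw [← e, getElem?_pre X (hi hj), hX j hj] at h
  exact (Option.some.inj h).symm

theorem coinMeasure_real_zerosAt {i : ℕ → ℕ} (hi : StrictMono i) (n : ℕ) :
    coinMeasure.real (zerosAt i n) = (1 / 2 : ℝ) ^ n := by
  induction n with
  | zero => simp [zerosAt_zero]
  | succ n ih =>
    rw [zerosAt_succ, coinMeasure_real_inter_coord (determinedBelow_zerosAt hi n), ih, pow_succ]
    ring

theorem coinMeasure_le_pow_iff {G : Set Cantor} {m : ℕ} :
    coinMeasure G ≤ (2⁻¹ : ENNReal) ^ m ↔ coinMeasure.real G ≤ (1 / 2 : ℝ) ^ m := by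
  rw [← ENNReal.toReal_le_toReal (measure_ne_top _ _) (by simp)]
  simp [ENNReal.toReal_pow, Measure.real]

/-- Each new zero halves the measure, and computability of `i` makes the clopen sets effective. The
first `i m` bits decide the `m`-th set, since `i j < i m` for `j < m`. -/
theorem isKurtzNull_zerosAt {i : ℕ → ℕ} (hi : StrictMono i) (hc : Computable i) :
    IsKurtzNull (⋂ n, zerosAt i n) := by
  let Z : List Bool → List ℕ → Prop := fun τ l => ∀ x ∈ l, τ[x]? = some false
  have hZ : PrimrecRel Z := by
    have h : PrimrecRel fun (x : ℕ) (τ : List Bool) => τ[x]? = some false :=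
      Primrec.eq.comp (Primrec.list_getElem?.comp Primrec.snd Primrec.fst) (.const _)
    exact h.forall_mem_list.swap
  have : DecidableRel Z := fun τ l => by unfold Z; infer_instance
  have hil : Computable fun n => (List.range n).map i := by
    have h := ComputableIn.list_map_range (O := ∅) hc.computableIn
    exact recursiveIn_empty_iff.1 h
  refine ⟨zerosAt i, ⟨⟨fun m => (strings (i m)).filter (Z · ((List.range m).map i)), ?_, ?_⟩, ?_⟩,
    rfl⟩
  · exact hZ.listFilter.to_comp.comp (primrec_strings.to_comp.comp hc) hil
  · intro m
    ext X
    simp only [mem_clopen_iff, List.mem_filter, mem_strings, decide_eq_true_iff]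
    have key : Z (pre X (i m)) ((List.range m).map i) ↔ X ∈ zerosAt i m := by
      simp only [Z, List.mem_map, List.mem_range, forall_exists_index, and_imp,
        forall_apply_eq_imp_iff₂]
      exact forall_congr' fun j => forall_congr' fun hj => by simp [getElem?_pre X (hi hj)]
    constructor
    · exact fun h => ⟨_, ⟨length_pre X (i m), key.2 h⟩, by simp⟩
    · rintro ⟨σ, ⟨hl, hσ⟩, e⟩
      rw [← e, hl] at hσ
      exact key.1 hσ
  · exact fun m => coinMeasure_le_pow_iff.2 (coinMeasure_real_zerosAt hi m).le

/-- If the positions `i n` grow fast enough compared to the complexity of clopen approximations of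
the open set `G`, then some sequence vanishing at all of them is outside `G`. -/
theorem exists_mem_zerosAt_notMem {G : Set Cantor} (hG : IsOpen G)
    (hG₁ : coinMeasure.real G ≤ 1 / 2) {D : ℕ → List (List Bool)}
    (hD : ∀ n, clopen (D n) ⊆ G ∧
      coinMeasure.real (G \ clopen (D n)) ≤ (1 / 2 : ℝ) ^ (2 * n + 3))
    {i : ℕ → ℕ} (hi : StrictMono i) (hDi : ∀ n, level (D n) ≤ i n) :
    ∃ X ∈ ⋂ n, zerosAt i n, X ∉ G := by
  -- Within `zerosAt i n` the set `G` has relative measure at most `1 - 2^{-(n+1)}`. The next zero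
  -- halves the part in `clopen (D n)`, which does not depend on position `i n`; the rest has
  -- measure at most `2^{-(2n+3)}`, raising the relative bound by exactly `2^{-(n+2)}`.
  have hbound : ∀ n, coinMeasure.real (G ∩ zerosAt i n) ≤
      (1 / 2 : ℝ) ^ n * (1 - (1 / 2) ^ (n + 1)) := by
    intro n
    induction n with
    | zero => rw [zerosAt_zero, Set.inter_univ]; norm_num at hG₁ ⊢; exact hG₁
    | succ n ih =>
      have hsub : G ∩ zerosAt i (n + 1) ⊆
          ((clopen (D n) ∩ zerosAt i n) ∩ {X | X (i n) = false}) ∪ (G \ clopen (D n)) := by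
        rintro X ⟨hXG, hX⟩
        rw [zerosAt_succ] at hX
        by_cases h : X ∈ clopen (D n)
        · exact .inl ⟨⟨h, hX.1⟩, hX.2⟩
        · exact .inr ⟨hXG, h⟩
      have h₁ := (measureReal_mono (μ := coinMeasure) hsub).trans (measureReal_union_le _ _)
      rw [coinMeasure_real_inter_coord (((determinedBelow_clopen (D n)).mono (hDi n)).inter
        (determinedBelow_zerosAt hi n))] at h₁
      have h₂ : coinMeasure.real (clopen (D n) ∩ zerosAt i n) ≤
          coinMeasure.real (G ∩ zerosAt i n) :=
        measureReal_mono (Set.inter_subset_inter_left _ (hD n).1)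
      have h₃ := (hD n).2
      have h₄ : (1 / 2 : ℝ) ^ (2 * n + 3) = (1 / 2) ^ n * (1 / 2) ^ n / 8 := by
        rw [pow_add, two_mul, pow_add]; ring
      have h₅ : (1 / 2 : ℝ) ^ (n + 1 + 1) = (1 / 2) ^ n / 4 := by ring
      have h₆ : (1 / 2 : ℝ) ^ (n + 1) = (1 / 2) ^ n / 2 := by ring
      rw [h₆] at ih
      rw [h₅, h₆]
      rw [h₄] at h₃
      linarith
  have hne : ∀ n, (zerosAt i n ∩ Gᶜ).Nonempty := by
    intro n
    by_contra hemp
    have hsub : zerosAt i n ⊆ G := fun X hX => by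
      by_contra h
      exact hemp ⟨X, hX, h⟩
    have h := hbound n
    rw [Set.inter_eq_right.2 hsub, coinMeasure_real_zerosAt hi] at h
    have : (0 : ℝ) < (1 / 2) ^ n * (1 / 2) ^ (n + 1) := by positivity
    linarith
  have hclosed : ∀ n, IsClosed (zerosAt i n ∩ Gᶜ) := fun n =>
    (isClosed_zerosAt i n).inter hG.isClosed_compl
  -- Compactness turns a point outside `G` at each finite level into one for all levels.
  obtain ⟨X, hX⟩ := IsCompact.nonempty_iInter_of_sequence_nonempty_isCompact_isClosed
    (fun n => zerosAt i n ∩ Gᶜ)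
    (fun n => Set.inter_subset_inter_left _ (by rw [zerosAt_succ]; exact Set.inter_subset_left))
    hne (hclosed 0).isCompact hclosed
  rw [Set.mem_iInter] at hX
  exact ⟨X, Set.mem_iInter.2 fun n => (hX n).1, (hX 0).2⟩

theorem exists_computable_strictMono_ge {g : ℕ → ℕ} (hg : Computable g) :
    ∃ i : ℕ → ℕ, Computable i ∧ StrictMono i ∧ ∀ n, g n ≤ i n := by
  let s : ℕ → ℕ := fun n => Nat.rec (motive := fun _ => ℕ) 0 (fun y r => r + g y + 1) n
  have hs : Computable s :=
    Computable.nat_rec .id (.const 0) (Primrec.succ.to_comp.comp (Primrec.nat_add.to_comp.comp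
      (Computable.snd.comp .snd) (hg.comp (Computable.fst.comp .snd)))).to₂
  have hstep : ∀ n, s (n + 1) = s n + g n + 1 := fun n => rfl
  refine ⟨fun n => s (n + 1), hs.comp .succ, strictMono_nat_of_lt_succ fun n => ?_, fun n => ?_⟩
  · rw [hstep (n + 1)]; lia
  · have := hstep n
    dsimp only
    lia

/-- The finitely many exceptional values are absorbed into an additive constant. -/
theorem exists_computable_ge_of_eventually_le {f g : ℕ → ℕ} (hg : Computable g)
    (h : ∀ᶠ n in atTop, f n ≤ g n) : ∃ g' : ℕ → ℕ, Computable g' ∧ ∀ n, f n ≤ g' n := by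
  obtain ⟨N, hN⟩ := eventually_atTop.1 h
  refine ⟨fun n => g n + ∑ j ∈ Finset.range N, f j,
    Primrec.nat_add.to_comp.comp hg (.const _), fun n => ?_⟩
  rcases lt_or_ge n N with hn | hn
  · exact (Finset.single_le_sum (f := f) (fun _ _ => Nat.zero_le _)
      (Finset.mem_range.2 hn)).trans (Nat.le_add_left _ _)
  · exact (hN n hn).trans (Nat.le_add_right _ _)

/-- The undominated function is the length bound for the approximations to `G 1`, the component
whose bound `1/2` starts the measure induction. -/
theorem IsSchnorrKurtzEngulfing.isOfHyperimmuneDegree {A : Cantor}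
    (hA : IsSchnorrKurtzEngulfing A) : IsOfHyperimmuneDegree A := by
  obtain ⟨G, hG, hsub⟩ := hA
  obtain ⟨D, hDc, hD⟩ := hG.exists_approx 1
  refine ⟨fun n => level (D n), primrec_level.computableIn.comp hDc, fun g hg hle => ?_⟩
  obtain ⟨g', hg', hle'⟩ := exists_computable_ge_of_eventually_le hg hle
  obtain ⟨i, hic, hi, hgi⟩ := exists_computable_strictMono_ge hg'
  have hG₁ : coinMeasure.real (G 1) ≤ 1 / 2 := by
    simpa only [pow_one] using coinMeasure_le_pow_iff.1 (hG.2.1 1)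
  obtain ⟨X, hX, hXG⟩ := exists_mem_zerosAt_notMem (hG.1.isOpen 1) hG₁ hD hi
    fun n => (hle' n).trans (hgi n)
  exact hXG (Set.mem_iInter.1 (hsub ⟨_, isKurtzNull_zerosAt hi hic, hX⟩) 1)

/-! ### Hyperimmune degree implies engulfing -/

open Nat.Partrec (Code)

/-- The bounds are geometric with sum exactly `2^{-k}`. This serves both the union over programs and
the tails of the levels. -/
theorem coinMeasure_iUnion_le {U : ℕ → Set Cantor} {k : ℕ}
    (h : ∀ j, coinMeasure (U j) ≤ (2⁻¹ : ENNReal) ^ (k + j + 1)) :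
    coinMeasure (⋃ j, U j) ≤ (2⁻¹ : ENNReal) ^ k := by
  refine (measure_iUnion_le U).trans ((ENNReal.tsum_le_tsum h).trans (le_of_eq ?_))
  simp_rw [pow_add, mul_assoc, ENNReal.tsum_mul_left, ENNReal.tsum_mul_right,
    ENNReal.tsum_geometric, ENNReal.one_sub_inv_two, inv_inv, pow_one]
  rw [ENNReal.mul_inv_cancel (by simp) (by simp), mul_one]

/-- The clopen set given by `D` has measure at most `2^{-k}`. -/
def Small (D : List (List Bool)) (k : ℕ) : Prop := count D * 2 ^ k ≤ 2 ^ level D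

instance : DecidableRel Small := fun D k => by unfold Small; infer_instance

theorem small_iff {D : List (List Bool)} {k : ℕ} :
    Small D k ↔ coinMeasure (clopen D) ≤ (2⁻¹ : ENNReal) ^ k := by
  rw [coinMeasure_le_pow_iff, coinMeasure_real_clopen, one_div_pow,
    div_le_div_iff₀ (by positivity) (by positivity), one_mul, Small, ← Nat.cast_le (α := ℝ)]
  push_cast
  rfl

theorem primrecRel_small : PrimrecRel Small :=
  Primrec.nat_le.comp
    (Primrec.nat_mul.comp (primrec_count.comp .fst) (primrec_pow.comp (.const 2) .snd))
    (primrec_pow.comp (.const 2) (primrec_level.comp .fst))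

/-- The list of strings output within `t` steps by the program with number `e` on input `k`,
replaced by the empty list if it describes a set of measure more than `2^{-k}`. -/
def guardedOutput (t e k : ℕ) : List (List Bool) :=
  let D : List (List Bool) :=
    -- A computation not finished, or an output coding no list, counts as the empty set.
    ((Code.evaln t (Denumerable.ofNat Code e) k).bind Encodable.decode).getD []
  if Small D k then D else []

theorem coinMeasure_guardedOutput_le (t e k : ℕ) :
    coinMeasure (clopen (guardedOutput t e k)) ≤ (2⁻¹ : ENNReal) ^ k := by
  unfold guardedOutput
  dsimp only
  split_ifs with h
  · exact small_iff.1 h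
  · simp [clopen]

theorem primrec_guardedOutput :
    Primrec fun x : (ℕ × ℕ) × ℕ => guardedOutput x.1.1 x.1.2 x.2 := by
  have hD : Primrec fun x : (ℕ × ℕ) × ℕ =>
      ((Code.evaln x.1.1 (Denumerable.ofNat Code x.1.2) x.2).bind
        (Encodable.decode (α := List (List Bool)))).getD [] :=
    Primrec.option_getD.comp (Primrec.option_bind
      (Code.primrec_evaln.comp (Primrec.pair (Primrec.pair (Primrec.fst.comp .fst)
        ((Primrec.ofNat Code).comp (Primrec.snd.comp .fst))) .snd))
      (Primrec.decode.comp .snd).to₂) (.const [])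
  exact Primrec.ite (primrecRel_small.comp hD .snd) hD (.const [])

/-- The union of the guarded outputs on input `n + e + 2` after `t` steps of all programs
with number `e ≤ n`. -/
def stageSet (n t : ℕ) : List (List Bool) :=
  (List.range (n + 1)).flatMap fun e => guardedOutput t e (n + e + 2)

theorem primrec_stageSet : Primrec₂ stageSet :=
  Primrec.list_flatMap (Primrec.list_range.comp (Primrec.succ.comp .fst))
    (primrec_guardedOutput.comp (Primrec.pair
      (Primrec.pair (Primrec.snd.comp .fst) .snd)
      (Primrec.nat_add.comp (Primrec.nat_add.comp (Primrec.fst.comp .fst) .snd) (.const 2)))).to₂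

theorem mem_clopen_flatMap {α : Type*} {l : List α} {F : α → List (List Bool)} {X : Cantor} :
    X ∈ clopen (l.flatMap F) ↔ ∃ a ∈ l, X ∈ clopen (F a) := by
  simp only [mem_clopen_iff, List.mem_flatMap]
  exact ⟨fun ⟨σ, ⟨a, ha, hσ⟩, h⟩ => ⟨a, ha, σ, hσ, h⟩, fun ⟨a, ha, σ, hσ, h⟩ => ⟨σ, ⟨a, ha, hσ⟩, h⟩⟩

theorem coinMeasure_stageSet_le (n t : ℕ) :
    coinMeasure (clopen (stageSet n t)) ≤ (2⁻¹ : ENNReal) ^ (n + 1) := by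
  refine (measure_mono ?_).trans
    (coinMeasure_iUnion_le (U := fun e => clopen (guardedOutput t e (n + e + 2))) fun e => ?_)
  · intro X hX
    obtain ⟨e, -, h⟩ := mem_clopen_flatMap.1 hX
    exact Set.mem_iUnion.2 ⟨e, h⟩
  · rw [show n + 1 + e + 1 = n + e + 2 by lia]
    exact coinMeasure_guardedOutput_le t e _

/-- The numerator of a dyadic rational with denominator `2 ^ k` that approximates the measure of
the clopen set given by `D` from above. -/
def upperApprox (x : List (List Bool) × ℕ) : ℕ := count x.1 * 2 ^ x.2 / 2 ^ level x.1 + 1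

theorem primrec_upperApprox : Primrec upperApprox :=
  Primrec.succ.comp (Primrec.nat_div.comp
    (Primrec.nat_mul.comp (primrec_count.comp .fst) (primrec_pow.comp (.const 2) .snd))
    (primrec_pow.comp (.const 2) (primrec_level.comp .fst)))

theorem upperApprox_bounds (D : List (List Bool)) (k : ℕ) :
    coinMeasure.real (clopen D) < (upperApprox (D, k) : ℝ) / 2 ^ k ∧
      (upperApprox (D, k) : ℝ) / 2 ^ k ≤ coinMeasure.real (clopen D) + (1 / 2) ^ k := by
  rw [coinMeasure_real_clopen, upperApprox]
  constructor
  · rw [div_lt_div_iff₀ (by positivity) (by positivity)]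
    have := Nat.lt_div_mul_add (a := count D * 2 ^ k) (b := 2 ^ level D) (by positivity)
    rw [← Nat.succ_mul] at this
    exact_mod_cast this
  · have h : ((count D * 2 ^ k / 2 ^ level D : ℕ) : ℝ) / 2 ^ k ≤
        (count D : ℝ) / 2 ^ level D := by
      rw [div_le_div_iff₀ (by positivity) (by positivity)]
      exact_mod_cast Nat.div_mul_le_self (count D * 2 ^ k) (2 ^ level D)
    rw [one_div_pow, Nat.cast_succ, add_div]
    linarith

/-- The tail unions of a sequence of clopen sets of rapidly decreasing measure that is computable
in `A` form a Schnorr test relative to `A`. -/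
theorem isSchnorrTestIn_tails {A : Cantor} {v : ℕ → List (List Bool)} (hv : ComputableFrom A v)
    (hm : ∀ n, coinMeasure (clopen (v n)) ≤ (2⁻¹ : ENNReal) ^ (n + 1)) :
    IsSchnorrTestIn A fun m => ⋃ j, clopen (v (m + j)) := by
  have hle : ∀ m, coinMeasure (⋃ j, clopen (v (m + j))) ≤ (2⁻¹ : ENNReal) ^ m := fun m =>
    coinMeasure_iUnion_le fun j => hm (m + j)
  -- Stage `s` codes a tail index and a position in that list; positions past the end enumerate
  -- nothing.
  refine ⟨⟨fun x => (v (x.1 + x.2.unpair.1))[x.2.unpair.2]?, ?_, fun m => ?_⟩, hle, ?_⟩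
  · have h₁ : Primrec fun x : ℕ × ℕ => x.1 + x.2.unpair.1 :=
      Primrec.nat_add.comp .fst (Primrec.fst.comp (Primrec.unpair.comp .snd))
    have h₂ : Primrec fun x : ℕ × ℕ => x.2.unpair.2 :=
      Primrec.snd.comp (Primrec.unpair.comp .snd)
    have h₃ : Primrec fun x : List (List Bool) × ℕ => x.1[x.2]? := Primrec.list_getElem?
    exact h₃.computableIn.comp ((hv.comp h₁.computableIn).pair h₂.computableIn)
  · ext X
    simp only [Set.mem_iUnion, clopen, exists_prop, Set.mem_ofPred_eq, Option.mem_def]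
    constructor
    · rintro ⟨j, σ, hσ, hX⟩
      obtain ⟨l, hl⟩ := List.mem_iff_getElem?.1 hσ
      exact ⟨Nat.pair j l, σ, by simpa using hl, hX⟩
    · rintro ⟨s, σ, hσ, hX⟩
      exact ⟨s.unpair.1, σ, List.mem_of_getElem? hσ, hX⟩
  · let W : ℕ × ℕ → List (List Bool) := fun x => (((List.range (x.1 + x.2)).map v).drop x.1).flatten
    -- `W (m, k)` collects the first `k` sets of the tail; the remainder has measure at most
    -- `2^{-(m+k)}`.
    have hW : ComputableFrom A W := by
      have h : Primrec fun x : ℕ × List (List (List Bool)) => (x.2.drop x.1).flatten :=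
        Primrec.list_flatten.comp (Primrec.list_drop.comp .fst .snd)
      have hadd : Primrec fun x : ℕ × ℕ => x.1 + x.2 := Primrec.nat_add
      exact h.computableIn.comp (ComputableIn.fst.pair
        ((ComputableIn.list_map_range hv).comp hadd.computableIn))
    have hmem : ∀ m k X, X ∈ clopen (W (m, k)) ↔ ∃ j < k, X ∈ clopen (v (m + j)) := by
      intro m k X
      have : W (m, k) = (List.range k).flatMap fun j => v (m + j) := by
        simp only [W]
        rw [List.range_add, List.map_append, List.drop_left' (by simp), List.map_map]
        rfl
      rw [this, mem_clopen_flatMap]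
      simp
    refine ⟨fun x => upperApprox (W x, x.2), ?_, fun m k => ?_⟩
    · exact primrec_upperApprox.computableIn.comp (hW.pair ComputableIn.snd)
    · have hlow : coinMeasure.real (clopen (W (m, k))) ≤
          coinMeasure.real (⋃ j, clopen (v (m + j))) := by
        refine measureReal_mono fun X hX => ?_
        obtain ⟨j, -, hj⟩ := (hmem m k X).1 hX
        exact Set.mem_iUnion.2 ⟨j, hj⟩
      have hup : coinMeasure.real (⋃ j, clopen (v (m + j))) ≤
          coinMeasure.real (clopen (W (m, k))) + (1 / 2) ^ k := by
        have hsub : ⋃ j, clopen (v (m + j)) ⊆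
            clopen (W (m, k)) ∪ ⋃ j, clopen (v (m + k + j)) := by
          intro X hX
          obtain ⟨j, hj⟩ := Set.mem_iUnion.1 hX
          rcases lt_or_ge j k with h | h
          · exact .inl ((hmem m k X).2 ⟨j, h, hj⟩)
          · refine .inr (Set.mem_iUnion.2 ⟨j - k, ?_⟩)
            rwa [show m + k + (j - k) = m + j by lia]
        refine ((measureReal_mono hsub).trans (measureReal_union_le _ _)).trans ?_
        have h₁ := coinMeasure_le_pow_iff.1 (hle (m + k))
        have h₂ : (1 / 2 : ℝ) ^ (m + k) ≤ (1 / 2) ^ k :=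
          pow_le_pow_of_le_one (by norm_num) (by norm_num) (Nat.le_add_left _ _)
        linarith
      have h := upperApprox_bounds (W (m, k)) k
      change |coinMeasure.real (⋃ j, clopen (v (m + j))) -
        (upperApprox (W (m, k), k) : ℝ) / 2 ^ k| ≤ _
      -- The true measure and its approximation both lie in the same interval of length `2^{-k}`,
      -- starting at the measure of `clopen (W (m, k))`.
      rw [abs_le]
      constructor <;> linarith

/-- The guard never censors a genuine Kurtz test, which obeys the measure bound. -/
theorem guardedOutput_eq {c : Code} {t k : ℕ} {D : List (List Bool)}
    (h : Encodable.encode D ∈ Code.evaln t c k)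
    (hD : coinMeasure (clopen D) ≤ (2⁻¹ : ENNReal) ^ k) :
    guardedOutput t (Encodable.encode c) k = D := by
  rw [Option.mem_def] at h
  simp [guardedOutput, h, small_iff.2 hD]

theorem IsOfHyperimmuneDegree.isSchnorrKurtzEngulfing {A : Cantor}
    (hA : IsOfHyperimmuneDegree A) : IsSchnorrKurtzEngulfing A := by
  obtain ⟨f, hf, hdom⟩ := hA
  let v : ℕ → List (List Bool) := fun n => stageSet n (f n)
  have hv : ComputableFrom A v := by
    have h : Primrec fun x : ℕ × ℕ => stageSet x.1 x.2 := primrec_stageSet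
    have hid : ComputableFrom A fun n : ℕ => n := ComputableIn.id
    exact ComputableIn.comp (f := fun x : ℕ × ℕ => stageSet x.1 x.2) (g := fun n => (n, f n))
      h.computableIn (hid.pair hf)
  refine ⟨_, isSchnorrTestIn_tails hv fun n => coinMeasure_stageSet_le n (f n), ?_⟩
  rintro X ⟨K, ⟨G, ⟨⟨D, hDc, hD⟩, hG⟩, rfl⟩, hX⟩
  refine Set.mem_iInter.2 fun m => ?_
  obtain ⟨c, hc⟩ := Code.exists_code.1 hDc
  have heval : ∀ n, Encodable.encode (D n) ∈ c.eval n := fun n => by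
    rw [hc]; simp
  set e := Encodable.encode c with he
  have hp : Computable fun x : ℕ × ℕ => (Code.evaln x.2 c (x.1 + e + 2)).isSome :=
    (Primrec.option_isSome.comp (Code.primrec_evaln.comp (Primrec.pair
      (Primrec.pair .snd (.const c))
      (Primrec.nat_add.comp (Primrec.nat_add.comp .fst (.const e)) (.const 2))))).to_comp
  -- `g n` is a number of steps sufficient for program `e` on input `n + e + 2`; the empty oracle
  -- makes it plainly computable.
  obtain ⟨g, hg, hgt⟩ := ComputableIn.exists_search (O := ∅) hp.computableIn fun n => by
    obtain ⟨t, ht⟩ := Code.evaln_complete.1 (heval (n + e + 2))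
    exact ⟨t, Option.isSome_iff_exists.2 ⟨_, ht⟩⟩
  -- `n ≥ m` puts level `n` in the `m`-th tail, and `n ≥ e` ensures that program `e` is run there.
  obtain ⟨n, hn, hle⟩ : ∃ n ≥ max m e, g n < f n := by
    have h := hdom g (recursiveIn_empty_iff.1 hg)
    by_contra! hcon
    exact h (eventually_atTop.2 ⟨_, hcon⟩)
  obtain ⟨y, hy⟩ := Option.isSome_iff_exists.1 (hgt n)
  have hyD := Part.mem_unique (Code.evaln_sound hy) (heval (n + e + 2))
  have hout : guardedOutput (f n) e (n + e + 2) = D (n + e + 2) :=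
    guardedOutput_eq (Code.evaln_mono hle.le (hyD ▸ hy)) (hD _ ▸ hG _)
  refine Set.mem_iUnion.2 ⟨n - m, ?_⟩
  rw [show m + (n - m) = n by lia]
  refine mem_clopen_flatMap.2 ⟨e, List.mem_range.2 (by lia), ?_⟩
  rw [hout, ← hD]
  exact Set.mem_iInter.1 hX _

end SchnorrKurtz

theorem theorem5p2 (A : SchnorrKurtz.Cantor) :
    SchnorrKurtz.IsOfHyperimmuneDegree A ↔ SchnorrKurtz.IsSchnorrKurtzEngulfing A :=
  ⟨SchnorrKurtz.IsOfHyperimmuneDegree.isSchnorrKurtzEngulfing,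
    SchnorrKurtz.IsSchnorrKurtzEngulfing.isOfHyperimmuneDegree⟩
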